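/- Let $k:\mathbb{R}\to\mathbb{R}$ be a non-constant $C^\infty$ function with $k'\ge 0$ on $\mathbb{R}$ (the main case being $k(t)=t$), and put $K(x)=k(x_1)$ for $x=(x_1,x_2)\in\mathbb{R}^2$. Then there is no $C^\infty$ function $u:\mathbb{R}^2\to\mathbb{R}$ such that $$-\Delta u = K(x)\,e^{u}\quad\text{in }\mathbb{R}^2,$$ $$u(x)\le u(0)=0\quad\text{for all }x\in\mathbb{R}^2,\qquad \int_{\mathbb{R}^2}|K|\,e^{u}\,dx<\infty,\qquad A:=\int_{\mathbb{R}^2}K\,e^{u}\,dx>0.$$ In particular, for $K(x)=x_1$ there is no smooth solution with these properties and $A=\int_{\mathbb{R}^2}x_1e^{u}\,dx>0$. -/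

import Mathlib

open MeasureTheory
open scoped ContDiff Laplacian

/-!
The argument is a Pohozaev identity for translations in the first variable. Put `f = K eᵘ`, so that
`Δu = -f`. Since `∂₀ f = k'(x₀) eᵘ + f ∂₀u`, integrating against a cutoff `φ` gives
`∫ φ k'(x₀) eᵘ = -∫ f ∂₀φ - ∫ φ f ∂₀u`. If both terms on the right tend to zero along cutoffs
exhausting the plane, then `k' = 0` and `k` is constant. The first one is at most `Lip φ * ‖f‖₁`.

The second one, the self-force, needs no decay of the gradient. Were `u` the logarithmic potential of
`f`, then `∂₀u` would be the convolution of `f` with an odd kernel of size `1 / ‖w‖`, and exchanging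
the two variables in the resulting double integral replaces `φ x` by `(φ x - φ y) / 2`. The factor
`‖x - y‖` gained this way cancels the singularity of the kernel, and the self-force is again
`O(Lip φ)`, with a constant depending only on `‖f‖₁` (`abs_integral_odd_kernel_le`).

Singular kernels and Liouville's theorem are avoided by averaging `∂₀u` over annuli around `x`. Let
`rho β a` be a fixed radial density rescaled to `‖w‖ ~ a ^ (-1/2)`. A difference
`rho β a - rho β b` is the Laplacian of a smooth compactly supported radial function whose gradient is
odd and bounded by a multiple of `1 / ‖w‖`, uniformly in `a` and `b`; hence the difference of the
averages of `∂₀u` at two scales is the convolution of `Δu` with that gradient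
(`IsProfile.integral_pd_mul_rho_sub`). As `a → ∞` the averages tend to `∂₀u`
(`IsProfile.exists_abs_integral_mul_rho_sub_le`). As `b → 0` they tend to zero
(`IsProfile.exists_abs_integral_pd_mul_rho_le`): Green's identity bounds the growth of the averages
of `-u` by a logarithm, because `Δu` is integrable; as `-u ≥ 0`, these averages control `|u|`, and
one integration by parts gains a factor `b ^ (1/2)`.
-/

/-! ### Partial derivatives and the Laplacian -/

/-- The Euclidean plane. -/
abbrev Plane : Type := EuclideanSpace ℝ (Fin 2)

/-- The partial derivative `∂ᵢ g`, as the Fréchet derivative applied to the `i`-th basis vector. -/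
noncomputable def pd (i : Fin 2) (g : Plane → ℝ) (x : Plane) : ℝ :=
  fderiv ℝ g x (EuclideanSpace.single i 1)

/-- The Laplacian as the sum of the pure second partial derivatives; for smooth functions it agrees
with Mathlib's `Δ` (`laplacian_eq_lap`). -/
noncomputable def lap (g : Plane → ℝ) (x : Plane) : ℝ :=
  pd 0 (pd 0 g) x + pd 1 (pd 1 g) x

theorem contDiff_pd {g : Plane → ℝ} (hg : ContDiff ℝ ∞ g) (i : Fin 2) :
    ContDiff ℝ ∞ (pd i g) :=
  ContDiff.clm_apply (hg.fderiv_right (m := ∞) (by simp)) contDiff_const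

theorem contDiff_lap {g : Plane → ℝ} (hg : ContDiff ℝ ∞ g) : ContDiff ℝ ∞ (lap g) :=
  (contDiff_pd (contDiff_pd hg 0) 0).add (contDiff_pd (contDiff_pd hg 1) 1)

theorem pd_pd_eq {g : Plane → ℝ} (hg : ContDiff ℝ ∞ g) (i j : Fin 2) (x : Plane) :
    pd i (pd j g) x
      = fderiv ℝ (fderiv ℝ g) x (EuclideanSpace.single i 1) (EuclideanSpace.single j 1) := by
  have hd : DifferentiableAt ℝ (fderiv ℝ g) x :=
    ((hg.fderiv_right (m := ∞) (by simp)).differentiable (by simp)) x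
  unfold pd
  rw [fderiv_clm_apply hd (differentiableAt_const _)]
  simp

theorem pd_comm {g : Plane → ℝ} (hg : ContDiff ℝ ∞ g) (i j : Fin 2) (x : Plane) :
    pd i (pd j g) x = pd j (pd i g) x := by
  rw [pd_pd_eq hg, pd_pd_eq hg]
  exact ((contDiff_infty.1 hg 2).contDiffAt.isSymmSndFDerivAt (by simp)).eq _ _

theorem laplacian_eq_lap {g : Plane → ℝ} (hg : ContDiff ℝ ∞ g) (x : Plane) :
    (Δ g) x = lap g x := by
  rw [InnerProductSpace.laplacian_eq_iteratedFDeriv_orthonormalBasis g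
    (EuclideanSpace.basisFun (Fin 2) ℝ)]
  simp [Fin.sum_univ_two, iteratedFDeriv_two_apply, lap, pd_pd_eq hg]

theorem pd_add {g h : Plane → ℝ} (hg : ContDiff ℝ ∞ g) (hh : ContDiff ℝ ∞ h) (i : Fin 2)
    (x : Plane) : pd i (fun y => g y + h y) x = pd i g x + pd i h x := by
  unfold pd
  rw [fderiv_fun_add (hg.differentiable (by simp) x) (hh.differentiable (by simp) x)]
  rfl

theorem pd_mul {g h : Plane → ℝ} (hg : ContDiff ℝ ∞ g) (hh : ContDiff ℝ ∞ h) (i : Fin 2)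
    (x : Plane) : pd i (fun y => g y * h y) x = g x * pd i h x + h x * pd i g x := by
  unfold pd
  rw [fderiv_fun_mul (hg.differentiable (by simp) x) (hh.differentiable (by simp) x)]
  rfl

theorem lap_pd {g : Plane → ℝ} (hg : ContDiff ℝ ∞ g) (i : Fin 2) (x : Plane) :
    lap (pd i g) x = pd i (lap g) x := by
  have h (j : Fin 2) : pd j (pd j (pd i g)) x = pd i (pd j (pd j g)) x := by
    rw [show pd j (pd i g) = pd i (pd j g) from funext fun y => pd_comm hg j i y,
      pd_comm (contDiff_pd hg j)]
  have hl : pd i (lap g) x = pd i (pd 0 (pd 0 g)) x + pd i (pd 1 (pd 1 g)) x :=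
    pd_add (contDiff_pd (contDiff_pd hg 0) 0) (contDiff_pd (contDiff_pd hg 1) 1) i x
  rw [hl, lap, h, h]

theorem pd_comp_const_add (g : Plane → ℝ) (x : Plane) (i : Fin 2) (w : Plane) :
    pd i (fun w => g (x + w)) w = pd i g (x + w) := by
  unfold pd
  rw [fderiv_comp_add_left]

theorem lap_comp_const_add (g : Plane → ℝ) (x w : Plane) :
    lap (fun w => g (x + w)) w = lap g (x + w) := by
  have h (j : Fin 2) : pd j (fun w => g (x + w)) = fun w => pd j g (x + w) :=
    funext fun w => pd_comp_const_add g x j w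
  simp only [lap, h, pd_comp_const_add]

/-! ### Integration by parts -/

theorem hasCompactSupport_pd {g : Plane → ℝ} (hg : HasCompactSupport g) (i : Fin 2) :
    HasCompactSupport (pd i g) := by
  refine (hg.fderiv (𝕜 := ℝ)).mono fun x hx => ?_
  contrapose! hx
  simp only [Function.mem_support, ne_eq, not_not] at hx ⊢
  simp [pd, hx]

theorem integrable_mul_of_hasCompactSupport {g h : Plane → ℝ} (hg : Continuous g)
    (hh : Continuous h) (hs : HasCompactSupport h) : Integrable fun x => g x * h x :=
  (hg.mul hh).integrable_of_hasCompactSupport hs.mul_left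

theorem integral_pd_mul {g h : Plane → ℝ} (hg : ContDiff ℝ ∞ g) (hh : ContDiff ℝ ∞ h)
    (hs : HasCompactSupport h) (i : Fin 2) :
    ∫ x, pd i g x * h x = -∫ x, g x * pd i h x := by
  have := integral_mul_fderiv_eq_neg_fderiv_mul_of_integrable (μ := (volume : Measure Plane))
    (f := g) (g := h) (v := EuclideanSpace.single i 1)
    (integrable_mul_of_hasCompactSupport (contDiff_pd hg i).continuous hh.continuous hs)
    (integrable_mul_of_hasCompactSupport hg.continuous (contDiff_pd hh i).continuous
      (hasCompactSupport_pd hs i))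
    (integrable_mul_of_hasCompactSupport hg.continuous hh.continuous hs)
    (fun x _ => hg.differentiable (by simp) x) (fun x _ => hh.differentiable (by simp) x)
  unfold pd
  rw [this, neg_neg]

/-- Green's second identity against a compactly supported function. -/
theorem integral_mul_lap {g h : Plane → ℝ} (hg : ContDiff ℝ ∞ g) (hh : ContDiff ℝ ∞ h)
    (hs : HasCompactSupport h) :
    ∫ x, g x * lap h x = ∫ x, lap g x * h x := by
  have key (i : Fin 2) : ∫ x, g x * pd i (pd i h) x = ∫ x, pd i (pd i g) x * h x := by
    rw [integral_pd_mul (contDiff_pd hg i) hh hs,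
      integral_pd_mul hg (contDiff_pd hh i) (hasCompactSupport_pd hs i), neg_neg]
  have i1 (i : Fin 2) : Integrable fun x => g x * pd i (pd i h) x :=
    integrable_mul_of_hasCompactSupport hg.continuous (contDiff_pd (contDiff_pd hh i) i).continuous
      (hasCompactSupport_pd (hasCompactSupport_pd hs i) i)
  have i2 (i : Fin 2) : Integrable fun x => pd i (pd i g) x * h x :=
    integrable_mul_of_hasCompactSupport (contDiff_pd (contDiff_pd hg i) i).continuous
      hh.continuous hs
  simp only [lap, mul_add, add_mul]
  rw [integral_add (i1 0) (i1 1), integral_add (i2 0) (i2 1), key, key]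

/-! ### Radial functions -/

theorem contDiff_comp_norm_sq {h : ℝ → ℝ} (hh : ContDiff ℝ ∞ h) :
    ContDiff ℝ ∞ fun w : Plane => h (‖w‖ ^ 2) :=
  hh.comp (contDiff_norm_sq ℝ)

theorem pd_comp_norm_sq {h : ℝ → ℝ} (hh : ContDiff ℝ ∞ h) (i : Fin 2) (w : Plane) :
    pd i (fun w => h (‖w‖ ^ 2)) w = 2 * w i * deriv h (‖w‖ ^ 2) := by
  have h1 : HasFDerivAt (fun w : Plane => ‖w‖ ^ 2) (2 • (innerSL ℝ) w) w :=
    (hasStrictFDerivAt_norm_sq w).hasFDerivAt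
  have h2 := ((hh.differentiable (by simp) (‖w‖ ^ 2)).hasDerivAt).comp_hasFDerivAt w h1
  unfold pd
  rw [show (fun w : Plane => h (‖w‖ ^ 2)) = h ∘ fun w : Plane => ‖w‖ ^ 2 from rfl, h2.fderiv]
  simp [EuclideanSpace.inner_single_right]
  ring

theorem contDiff_coord (i : Fin 2) : ContDiff ℝ ∞ fun w : Plane => w i := by
  fun_prop

theorem pd_coord (i : Fin 2) (w : Plane) : pd i (fun w => w i) w = 1 := by
  unfold pd
  have : HasFDerivAt (fun w : Plane => w i) (EuclideanSpace.proj i : Plane →L[ℝ] ℝ) w :=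
    (EuclideanSpace.proj i : Plane →L[ℝ] ℝ).hasFDerivAt
  rw [this.fderiv]
  simp

theorem contDiff_deriv {h : ℝ → ℝ} (hh : ContDiff ℝ ∞ h) : ContDiff ℝ ∞ (deriv h) := by
  simpa using (contDiff_infty_iff_deriv.1 hh).2

/-- The Laplacian of a radial function: with `s = ‖w‖²`, `Δ h(s) = 4 (h'(s) + s h''(s))`. -/
theorem lap_comp_norm_sq {h : ℝ → ℝ} (hh : ContDiff ℝ ∞ h) (w : Plane) :
    lap (fun w => h (‖w‖ ^ 2)) w
      = 4 * (deriv h (‖w‖ ^ 2) + ‖w‖ ^ 2 * deriv (deriv h) (‖w‖ ^ 2)) := by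
  have hd := contDiff_deriv hh
  have key (i : Fin 2) : pd i (pd i fun w => h (‖w‖ ^ 2)) w
      = 2 * deriv h (‖w‖ ^ 2) + 4 * (w i) ^ 2 * deriv (deriv h) (‖w‖ ^ 2) := by
    have e : (pd i fun w => h (‖w‖ ^ 2))
        = fun w => w i * ((fun s => 2 * deriv h s) (‖w‖ ^ 2)) := by
      funext w; rw [pd_comp_norm_sq hh]; ring
    have h2 : ContDiff ℝ ∞ fun s => 2 * deriv h s := contDiff_const.mul hd
    rw [e, pd_mul (contDiff_coord i) (contDiff_comp_norm_sq h2), pd_coord, pd_comp_norm_sq h2,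
      deriv_const_mul _ (hd.differentiable (by simp) _)]
    ring
  have hn : ‖w‖ ^ 2 = w 0 ^ 2 + w 1 ^ 2 := by
    rw [EuclideanSpace.real_norm_sq_eq, Fin.sum_univ_two]
  rw [lap, key, key]
  linear_combination (-4 * deriv (deriv h) (‖w‖ ^ 2)) * hn

theorem hasCompactSupport_comp_norm_sq {h : ℝ → ℝ} {c : ℝ} (hc : ∀ s, c ≤ s → h s = 0) :
    HasCompactSupport fun w : Plane => h (‖w‖ ^ 2) := by
  refine HasCompactSupport.of_support_subset_isCompact
    (isCompact_closedBall (0 : Plane) (c + 1)) fun w hw => ?_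
  by_contra hn
  rw [mem_closedBall_zero_iff, not_le] at hn
  refine hw (hc _ ?_)
  nlinarith [norm_nonneg w, sq_nonneg (‖w‖ - 1)]

/-! ### Radial densities and their potentials -/

/-- A radial profile: a smooth nonnegative function of `s = ‖w‖²` supported in `[1, 5]`. -/
structure IsProfile (β : ℝ → ℝ) : Prop where
  smooth : ContDiff ℝ ∞ β
  nonneg : ∀ s, 0 ≤ β s
  eq_zero_left : ∀ s, s ≤ 1 → β s = 0
  eq_zero_right : ∀ s, 5 ≤ s → β s = 0

/-- The mass of a profile below level `s`. -/
noncomputable def mass (β : ℝ → ℝ) (s : ℝ) : ℝ := ∫ x in (0 : ℝ)..s, β x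

/-- The profile `β` rescaled to the annulus `1 ≤ a ‖w‖² ≤ 5`; the factor makes its integral over
the plane independent of `a`. -/
noncomputable def rho (β : ℝ → ℝ) (a : ℝ) (w : Plane) : ℝ := 2 * a * β (a * ‖w‖ ^ 2)

/-- The derivative, in the variable `s = ‖w‖²`, of the radial potential of `rho β a - rho β b`. The
numerator vanishes near `s = 0`, so the junk value of the quotient there is the right one. -/
noncomputable def radialSlope (β : ℝ → ℝ) (a b s : ℝ) : ℝ :=
  (mass β (a * s) - mass β (b * s)) / (2 * s)

/-- The compactly supported radial function whose Laplacian is `rho β a - rho β b`, written in the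
variable `s = ‖w‖²`. The base point `5 / b` lies beyond the support of the slope when `b ≤ a`. -/
noncomputable def profilePotential (β : ℝ → ℝ) (a b s : ℝ) : ℝ :=
  ∫ x in (5 / b)..s, radialSlope β a b x

namespace IsProfile

variable {β : ℝ → ℝ} {a b : ℝ}

theorem hasDerivAt_mass (hβ : IsProfile β) (s : ℝ) : HasDerivAt (mass β) (β s) s :=
  hβ.smooth.continuous.integral_hasStrictDerivAt 0 s |>.hasDerivAt

theorem contDiff_mass (hβ : IsProfile β) : ContDiff ℝ ∞ (mass β) := by
  rw [contDiff_infty_iff_deriv]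
  refine ⟨fun s => (hβ.hasDerivAt_mass s).differentiableAt, ?_⟩
  rw [show deriv (mass β) = β from funext fun s => (hβ.hasDerivAt_mass s).deriv]
  exact hβ.smooth

theorem monotone_mass (hβ : IsProfile β) : Monotone (mass β) :=
  monotone_of_deriv_nonneg (fun s => (hβ.hasDerivAt_mass s).differentiableAt)
    fun s => by rw [(hβ.hasDerivAt_mass s).deriv]; exact hβ.nonneg s

theorem mass_eq_zero (hβ : IsProfile β) {s : ℝ} (hs : s ≤ 1) : mass β s = 0 := by
  rw [mass, intervalIntegral.integral_congr (g := fun _ => 0), intervalIntegral.integral_zero]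
  intro x hx
  refine hβ.eq_zero_left x ?_
  rcases Set.mem_uIcc.1 hx with h | h <;> linarith [h.1, h.2]

theorem mass_eq_of_ge (hβ : IsProfile β) {s : ℝ} (hs : 5 ≤ s) : mass β s = mass β 5 := by
  have hi (c d : ℝ) : IntervalIntegrable β volume c d := hβ.smooth.continuous.intervalIntegrable c d
  have h0 : ∫ x in (5 : ℝ)..s, β x = 0 := by
    rw [intervalIntegral.integral_congr (g := fun _ => 0), intervalIntegral.integral_zero]
    intro x hx
    rw [Set.uIcc_of_le hs] at hx
    exact hβ.eq_zero_right x hx.1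
  rw [mass, mass, ← intervalIntegral.integral_add_adjacent_intervals (hi 0 5) (hi 5 s), h0, add_zero]

theorem mass_nonneg (hβ : IsProfile β) (s : ℝ) : 0 ≤ mass β s := by
  rcases le_total s 1 with h | h
  · rw [hβ.mass_eq_zero h]
  · exact (hβ.mass_eq_zero le_rfl).symm.le.trans (hβ.monotone_mass h)

theorem mass_le (hβ : IsProfile β) (s : ℝ) : mass β s ≤ mass β 5 := by
  rcases le_total s 5 with h | h
  · exact hβ.monotone_mass h
  · rw [hβ.mass_eq_of_ge h]

theorem abs_mass_sub_le (hβ : IsProfile β) (s t : ℝ) : |mass β s - mass β t| ≤ mass β 5 := by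
  rw [abs_le]
  constructor <;> linarith [hβ.mass_nonneg s, hβ.mass_nonneg t, hβ.mass_le s, hβ.mass_le t]

theorem mul_radialSlope (hβ : IsProfile β) (s : ℝ) :
    s * radialSlope β a b s = (mass β (a * s) - mass β (b * s)) / 2 := by
  rcases eq_or_ne s 0 with rfl | hs
  · simp [hβ.mass_eq_zero zero_le_one]
  · rw [radialSlope]; field_simp

theorem radialSlope_eq_zero_of_le (hβ : IsProfile β) {s : ℝ} (h1 : a * s ≤ 1) (h2 : b * s ≤ 1) :
    radialSlope β a b s = 0 := by
  simp [radialSlope, hβ.mass_eq_zero h1, hβ.mass_eq_zero h2]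

theorem radialSlope_eq_zero_of_ge (hβ : IsProfile β) (hb : 0 < b) (hab : b ≤ a) {s : ℝ}
    (hs : 5 / b ≤ s) : radialSlope β a b s = 0 := by
  have h1 : 5 ≤ b * s := by rwa [div_le_iff₀' hb] at hs
  have hs0 : 0 ≤ s := (by positivity : 0 ≤ 5 / b).trans hs
  have h2 : 5 ≤ a * s := h1.trans (mul_le_mul_of_nonneg_right hab hs0)
  simp [radialSlope, hβ.mass_eq_of_ge h1, hβ.mass_eq_of_ge h2]

theorem contDiff_radialSlope (hβ : IsProfile β) : ContDiff ℝ ∞ (radialSlope β a b) := by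
  rw [contDiff_iff_contDiffAt]
  intro s
  rcases eq_or_ne s 0 with rfl | hs
  · have ha : ∀ᶠ s in nhds (0 : ℝ), a * s < 1 :=
      (continuous_const.mul continuous_id).continuousAt.eventually_lt continuousAt_const (by simp)
    have hb : ∀ᶠ s in nhds (0 : ℝ), b * s < 1 :=
      (continuous_const.mul continuous_id).continuousAt.eventually_lt continuousAt_const (by simp)
    refine (contDiffAt_const (c := (0 : ℝ))).congr_of_eventuallyEq ?_
    filter_upwards [ha, hb] with s h1 h2 using hβ.radialSlope_eq_zero_of_le h1.le h2.le
  · have hm (c : ℝ) : ContDiff ℝ ∞ fun s => mass β (c * s) :=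
      hβ.contDiff_mass.comp (contDiff_const.mul contDiff_id)
    exact ((hm a).sub (hm b)).contDiffAt.div (contDiff_const.mul contDiff_id).contDiffAt
      (mul_ne_zero two_ne_zero hs)

theorem hasDerivAt_profilePotential (hβ : IsProfile β) (s : ℝ) :
    HasDerivAt (profilePotential β a b) (radialSlope β a b s) s :=
  hβ.contDiff_radialSlope.continuous.integral_hasStrictDerivAt _ s |>.hasDerivAt

theorem deriv_profilePotential (hβ : IsProfile β) :
    deriv (profilePotential β a b) = radialSlope β a b :=
  funext fun s => (hβ.hasDerivAt_profilePotential s).deriv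

theorem contDiff_profilePotential (hβ : IsProfile β) : ContDiff ℝ ∞ (profilePotential β a b) := by
  rw [contDiff_infty_iff_deriv]
  refine ⟨fun s => (hβ.hasDerivAt_profilePotential s).differentiableAt, ?_⟩
  rw [hβ.deriv_profilePotential]
  exact hβ.contDiff_radialSlope

theorem profilePotential_eq_zero (hβ : IsProfile β) (hb : 0 < b) (hab : b ≤ a) {s : ℝ}
    (hs : 5 / b ≤ s) : profilePotential β a b s = 0 := by
  rw [profilePotential, intervalIntegral.integral_congr (g := fun _ => 0),
    intervalIntegral.integral_zero]
  intro x hx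
  rw [Set.uIcc_of_le hs] at hx
  exact hβ.radialSlope_eq_zero_of_ge hb hab hx.1

/-- The potential between the scales `1` and `b ≤ 1` is at most logarithmic in `b`. -/
theorem abs_profilePotential_le (hβ : IsProfile β) (hb : 0 < b) (hb1 : b ≤ 1) (s : ℝ) :
    |profilePotential β 1 b s| ≤ mass β 5 / 2 * Real.log (5 / b) := by
  have hQ := hβ.mass_nonneg 5
  have h5 : 1 ≤ 5 / b := by rw [le_div_iff₀ hb]; linarith
  have main {s : ℝ} (hs1 : 1 ≤ s) (hs : s ≤ 5 / b) :
      |profilePotential β 1 b s| ≤ mass β 5 / 2 * Real.log (5 / b) := by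
    have hbd : ∀ x ∈ Set.Ioc s (5 / b), ‖radialSlope β 1 b x‖ ≤ mass β 5 / 2 * x⁻¹ := by
      intro x hx
      have hx0 : 0 < x := by linarith [hx.1]
      rw [radialSlope, norm_div, Real.norm_eq_abs, Real.norm_eq_abs,
        abs_of_pos (by positivity : 0 < 2 * x),
        div_le_iff₀ (by positivity)]
      refine (hβ.abs_mass_sub_le _ _).trans_eq ?_
      field_simp
    have hint : IntervalIntegrable (fun x : ℝ => mass β 5 / 2 * x⁻¹) volume s (5 / b) := by
      refine (intervalIntegral.intervalIntegrable_inv ?_ continuousOn_id).const_mul _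
      intro x hx
      rw [Set.uIcc_of_le hs] at hx
      exact (by simp; linarith [hx.1])
    rw [profilePotential, intervalIntegral.integral_symm, abs_neg, ← Real.norm_eq_abs]
    refine (intervalIntegral.norm_integral_le_of_norm_le hs
      (Filter.Eventually.of_forall hbd) hint).trans ?_
    rw [intervalIntegral.integral_const_mul, integral_inv_of_pos (by linarith) (by linarith)]
    have hs0 : 0 < s := by linarith
    exact mul_le_mul_of_nonneg_left
      (Real.log_le_log (by positivity) (div_le_self (by positivity) hs1)) (by positivity)
  rcases le_total s 1 with h1 | h1
  · have : profilePotential β 1 b s = profilePotential β 1 b 1 := by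
      have hi (c d : ℝ) : IntervalIntegrable (radialSlope β 1 b) volume c d :=
        hβ.contDiff_radialSlope.continuous.intervalIntegrable c d
      rw [profilePotential, ← intervalIntegral.integral_add_adjacent_intervals (hi _ 1) (hi 1 s),
        intervalIntegral.integral_congr (a := 1) (g := fun _ => 0), intervalIntegral.integral_zero,
        add_zero, profilePotential]
      intro x hx
      rw [Set.uIcc_of_ge h1] at hx
      refine hβ.radialSlope_eq_zero_of_le (by linarith [hx.2]) ?_
      rcases le_total x 0 with h | h <;> nlinarith [hx.2]
    rw [this]
    exact main le_rfl h5
  · rcases le_total s (5 / b) with h2 | h2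
    · exact main h1 h2
    · rw [hβ.profilePotential_eq_zero hb hb1 h2, abs_zero]
      exact mul_nonneg (by positivity) (Real.log_nonneg h5)

theorem lap_profilePotential (hβ : IsProfile β) (w : Plane) :
    lap (fun w => profilePotential β a b (‖w‖ ^ 2)) w = rho β a w - rho β b w := by
  rw [lap_comp_norm_sq hβ.contDiff_profilePotential, hβ.deriv_profilePotential]
  set s := ‖w‖ ^ 2 with hs
  -- differentiate `s * radialSlope s = (mass (a s) - mass (b s)) / 2` in two ways
  have hm (c : ℝ) : HasDerivAt (fun s => mass β (c * s)) (β (c * s) * c) s := by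
    have := (hβ.hasDerivAt_mass (c * s)).comp s ((hasDerivAt_id s).const_mul c)
    simpa [Function.comp_def] using this
  have h1 : HasDerivAt (fun s => s * radialSlope β a b s)
      ((β (a * s) * a - β (b * s) * b) / 2) s := by
    rw [show (fun s => s * radialSlope β a b s) = fun s => (mass β (a * s) - mass β (b * s)) / 2 from
      funext fun s => hβ.mul_radialSlope s]
    exact ((hm a).sub (hm b)).div_const 2
  have h2 := (hasDerivAt_id s).mul ((hβ.contDiff_radialSlope (a := a) (b := b)).differentiable
    (by simp) s).hasDerivAt
  have h3 := h1.unique h2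
  simp only [id, one_mul] at h3
  rw [rho, rho, ← hs]
  linear_combination -4 * h3

theorem pd_profilePotential (hβ : IsProfile β) (i : Fin 2) (w : Plane) :
    pd i (fun w => profilePotential β a b (‖w‖ ^ 2)) w = 2 * w i * radialSlope β a b (‖w‖ ^ 2) := by
  rw [pd_comp_norm_sq hβ.contDiff_profilePotential, hβ.deriv_profilePotential]

/-- The first-order kernel is bounded by a multiple of `1 / ‖w‖`, uniformly in both scales. -/
theorem norm_mul_abs_pd_profilePotential_le (hβ : IsProfile β) (i : Fin 2) (w : Plane) :
    ‖w‖ * |pd i (fun w => profilePotential β a b (‖w‖ ^ 2)) w| ≤ mass β 5 := by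
  have h1 : |w i| ≤ ‖w‖ := by simpa using PiLp.norm_apply_le w i
  have h2 : ‖w‖ ^ 2 * |radialSlope β a b (‖w‖ ^ 2)| ≤ mass β 5 / 2 := by
    have h := congrArg abs (hβ.mul_radialSlope (a := a) (b := b) (‖w‖ ^ 2))
    rw [abs_mul, abs_of_nonneg (sq_nonneg ‖w‖), abs_div, abs_two] at h
    rw [h]
    exact div_le_div_of_nonneg_right (hβ.abs_mass_sub_le _ _) zero_le_two
  rw [hβ.pd_profilePotential, abs_mul, abs_mul, abs_two]
  nlinarith [mul_le_mul_of_nonneg_right h1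
    (mul_nonneg (norm_nonneg w) (abs_nonneg (radialSlope β a b (‖w‖ ^ 2))))]

theorem hasCompactSupport_profilePotential (hβ : IsProfile β) (hb : 0 < b) (hab : b ≤ a) :
    HasCompactSupport fun w : Plane => profilePotential β a b (‖w‖ ^ 2) :=
  hasCompactSupport_comp_norm_sq fun _ => hβ.profilePotential_eq_zero hb hab

theorem contDiff_rho (hβ : IsProfile β) : ContDiff ℝ ∞ (rho β a) :=
  contDiff_const.mul (contDiff_comp_norm_sq (h := fun s => β (a * s))
    (hβ.smooth.comp (contDiff_const.mul contDiff_id)))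

theorem hasCompactSupport_rho (hβ : IsProfile β) (ha : 0 < a) : HasCompactSupport (rho β a) :=
  (hasCompactSupport_comp_norm_sq (h := fun s => β (a * s)) (c := 5 / a) fun s hs =>
    hβ.eq_zero_right _ (by rwa [div_le_iff₀' ha] at hs)).mul_left

end IsProfile

/-! ### Symmetrisation of the double integral -/

/-- **Symmetrisation.** Against an odd kernel of size `Q / ‖w‖`, the quadratic expression in `f`
only sees the difference quotients of the weight `φ`, so that `f ∈ L¹` suffices. -/
theorem abs_integral_odd_kernel_le {f φ κ : Plane → ℝ} {L Q B : ℝ} (hf : Integrable f)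
    (hφ : Continuous φ) (hφB : ∀ x, |φ x| ≤ B) (hφL : ∀ x y, |φ x - φ y| ≤ L * ‖x - y‖)
    (hL : 0 ≤ L) (hκ : Continuous κ) (hκs : HasCompactSupport κ) (hodd : ∀ w, κ (-w) = -κ w)
    (hκQ : ∀ w, ‖w‖ * |κ w| ≤ Q) :
    |∫ x, φ x * f x * ∫ w, f (x + w) * κ w| ≤ L * Q / 2 * (∫ x, |f x|) ^ 2 := by
  obtain ⟨K, hK⟩ := hκ.bounded_above_of_compact_support hκs
  have hff : Integrable (fun p : Plane × Plane => f p.1 * f p.2) (volume.prod volume) :=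
    hf.mul_prod hf
  have hker : Continuous fun p : Plane × Plane => κ (p.2 - p.1) := by fun_prop
  have hφ1 : Continuous fun p : Plane × Plane => φ p.1 := by fun_prop
  have hφ2 : Continuous fun p : Plane × Plane => φ p.2 := by fun_prop
  have hB : 0 ≤ B := (abs_nonneg _).trans (hφB 0)
  have hint (ψ : Plane × Plane → ℝ) (hψ : Continuous ψ) (hb : ∀ p, |ψ p| ≤ B) :
      Integrable (fun p : Plane × Plane => (ψ p * κ (p.2 - p.1)) * (f p.1 * f p.2))
        (volume.prod volume) := by
    refine hff.bdd_mul (c := B * K) (hψ.mul hker).aestronglyMeasurable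
      (Filter.Eventually.of_forall fun p => ?_)
    rw [norm_mul]
    exact mul_le_mul (hb p) (hK _) (norm_nonneg _) hB
  have i1 := hint _ hφ1 fun p => hφB p.1
  have i2 := hint _ hφ2 fun p => hφB p.2
  have e1 : ∫ x, φ x * f x * ∫ w, f (x + w) * κ w
      = ∫ p : Plane × Plane, (φ p.1 * κ (p.2 - p.1)) * (f p.1 * f p.2) ∂(volume.prod volume) := by
    rw [integral_prod _ i1]
    congr 1
    funext x
    rw [← integral_add_left_eq_self (fun z => φ x * κ (z - x) * (f x * f z)) x,
      ← integral_const_mul]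
    congr 1
    funext w
    simp only [add_sub_cancel_left]
    ring
  have e2 : ∫ p : Plane × Plane, (φ p.1 * κ (p.2 - p.1)) * (f p.1 * f p.2) ∂(volume.prod volume)
      = -∫ p : Plane × Plane, (φ p.2 * κ (p.2 - p.1)) * (f p.1 * f p.2) ∂(volume.prod volume) := by
    rw [← integral_prod_swap, ← integral_neg]
    congr 1
    funext p
    simp only [Prod.fst_swap, Prod.snd_swap]
    rw [← neg_sub p.2 p.1, hodd]
    ring
  rw [e1]
  have e3 : 2 * ∫ p : Plane × Plane, (φ p.1 * κ (p.2 - p.1)) * (f p.1 * f p.2)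
        ∂(volume.prod volume)
      = ∫ p : Plane × Plane, ((φ p.1 - φ p.2) * κ (p.2 - p.1)) * (f p.1 * f p.2)
        ∂(volume.prod volume) := by
    simp only [sub_mul]
    rw [integral_sub i1 i2]
    linarith
  have hbd : ‖∫ p : Plane × Plane, ((φ p.1 - φ p.2) * κ (p.2 - p.1)) * (f p.1 * f p.2)
        ∂(volume.prod volume)‖
      ≤ ∫ p : Plane × Plane, L * Q * (|f p.1| * |f p.2|) ∂(volume.prod volume) := by
    refine norm_integral_le_of_norm_le ((hf.abs.mul_prod hf.abs).const_mul _)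
      (Filter.Eventually.of_forall fun p => ?_)
    rw [norm_mul, norm_mul, norm_mul]
    simp only [Real.norm_eq_abs]
    refine mul_le_mul_of_nonneg_right ?_ (by positivity)
    calc |φ p.1 - φ p.2| * |κ (p.2 - p.1)| ≤ L * ‖p.1 - p.2‖ * |κ (p.2 - p.1)| :=
          mul_le_mul_of_nonneg_right (hφL _ _) (abs_nonneg _)
      _ = L * (‖p.2 - p.1‖ * |κ (p.2 - p.1)|) := by rw [norm_sub_rev]; ring
      _ ≤ L * Q := mul_le_mul_of_nonneg_left (hκQ _) hL
  rw [integral_const_mul, integral_prod_mul (fun x => |f x|) fun x => |f x|, ← e3,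
    Real.norm_eq_abs, abs_mul, abs_two] at hbd
  linarith

/-! ### Annular averages at two scales -/

namespace IsProfile

variable {β : ℝ → ℝ} {a b : ℝ} {u : Plane → ℝ}

theorem rho_nonneg (hβ : IsProfile β) (ha : 0 ≤ a) (w : Plane) : 0 ≤ rho β a w :=
  mul_nonneg (by positivity) (hβ.nonneg _)

/-- The integral of `rho β a` does not depend on `a`: the difference of two of them is the integral of
the Laplacian of a compactly supported function. -/
theorem integral_rho_eq (hβ : IsProfile β) (hb : 0 < b) (hab : b ≤ a) :
    ∫ w, rho β a w = ∫ w, rho β b w := by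
  have hi {c : ℝ} (hc : 0 < c) : Integrable (rho β c) :=
    hβ.contDiff_rho.continuous.integrable_of_hasCompactSupport (hβ.hasCompactSupport_rho hc)
  have h := integral_mul_lap (g := fun _ => (1 : ℝ)) contDiff_const
    (contDiff_comp_norm_sq hβ.contDiff_profilePotential)
    (hβ.hasCompactSupport_profilePotential hb hab)
  have h0 (w : Plane) : lap (fun _ : Plane => (1 : ℝ)) w = 0 := by
    have (i : Fin 2) (c : ℝ) : pd i (fun _ => c) = fun _ => 0 := by
      funext w; simp [pd]
    simp [lap, this]
  simp only [h0, hβ.lap_profilePotential, one_mul, zero_mul, integral_zero] at h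
  rw [integral_sub (hi (hb.trans_le hab)) (hi hb)] at h
  linarith

theorem integral_rho_pos (hβ : IsProfile β) {s : ℝ} (hs0 : 0 ≤ s) (hs : β s ≠ 0) :
    0 < ∫ w, rho β 1 w := by
  refine hβ.contDiff_rho.continuous.integral_pos_of_hasCompactSupport_nonneg_nonzero
    (hβ.hasCompactSupport_rho one_pos) (hβ.rho_nonneg zero_le_one)
    (x := EuclideanSpace.single 0 (Real.sqrt s)) ?_
  simp [rho, Real.sq_sqrt hs0, hs]

/-- Differences of averages of `∂ᵢ u` at two scales, as a convolution of `Δ u` with an odd kernel. -/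
theorem integral_pd_mul_rho_sub (hβ : IsProfile β) (hu : ContDiff ℝ ∞ u) (hb : 0 < b) (hab : b ≤ a)
    (i : Fin 2) (x : Plane) :
    (∫ w, pd i u (x + w) * rho β a w) - ∫ w, pd i u (x + w) * rho β b w
      = -∫ w, lap u (x + w) * pd i (fun w => profilePotential β a b (‖w‖ ^ 2)) w := by
  have htr : ContDiff ℝ ∞ fun w : Plane => x + w := contDiff_const.add contDiff_id
  have hg : ContDiff ℝ ∞ fun w => pd i u (x + w) := (contDiff_pd hu i).comp htr
  have hl : ContDiff ℝ ∞ fun w => lap u (x + w) := (contDiff_lap hu).comp htr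
  have hP : ContDiff ℝ ∞ fun w : Plane => profilePotential β a b (‖w‖ ^ 2) :=
    contDiff_comp_norm_sq hβ.contDiff_profilePotential
  have hPs := hβ.hasCompactSupport_profilePotential (a := a) hb hab
  have hi {c : ℝ} (hc : 0 < c) : Integrable fun w => pd i u (x + w) * rho β c w :=
    integrable_mul_of_hasCompactSupport hg.continuous hβ.contDiff_rho.continuous
      (hβ.hasCompactSupport_rho hc)
  rw [← integral_pd_mul hl hP hPs, ← integral_sub (hi (hb.trans_le hab)) (hi hb)]
  have h := integral_mul_lap hg hP hPs
  simp only [hβ.lap_profilePotential, lap_comp_const_add, mul_sub] at h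
  rw [h]
  simp only [lap_pd hu, pd_comp_const_add]

/-- For `u` with integrable Laplacian, the annular averages of `-u` grow at most logarithmically. -/
theorem integral_neg_mul_rho_le (hβ : IsProfile β) (hu : ContDiff ℝ ∞ u) (hl : Integrable (lap u))
    (hb : 0 < b) (hb1 : b ≤ 1) (x : Plane) :
    ∫ w, -u (x + w) * rho β b w
      ≤ (∫ w, -u (x + w) * rho β 1 w) + mass β 5 / 2 * Real.log (5 / b) * ∫ w, |lap u w| := by
  have htr : ContDiff ℝ ∞ fun w : Plane => x + w := contDiff_const.add contDiff_id
  have hg : ContDiff ℝ ∞ fun w => u (x + w) := hu.comp htr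
  have hi {c : ℝ} (hc : 0 < c) : Integrable fun w => u (x + w) * rho β c w :=
    integrable_mul_of_hasCompactSupport hg.continuous hβ.contDiff_rho.continuous
      (hβ.hasCompactSupport_rho hc)
  have h := integral_mul_lap hg (contDiff_comp_norm_sq hβ.contDiff_profilePotential)
    (hβ.hasCompactSupport_profilePotential hb hb1)
  simp only [hβ.lap_profilePotential, lap_comp_const_add, mul_sub] at h
  rw [integral_sub (hi one_pos) (hi hb)] at h
  have hbd : ‖∫ w, lap u (x + w) * profilePotential β 1 b (‖w‖ ^ 2)‖
      ≤ ∫ w, mass β 5 / 2 * Real.log (5 / b) * |lap u (x + w)| := by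
    refine norm_integral_le_of_norm_le ((hl.comp_add_left x).abs.const_mul _)
      (Filter.Eventually.of_forall fun w => ?_)
    rw [norm_mul, Real.norm_eq_abs, Real.norm_eq_abs, mul_comm]
    exact mul_le_mul_of_nonneg_right (hβ.abs_profilePotential_le hb hb1 _) (abs_nonneg _)
  rw [integral_const_mul, integral_add_left_eq_self (fun w => |lap u w|) x, Real.norm_eq_abs] at hbd
  simp only [neg_mul, integral_neg]
  linarith [le_abs_self (∫ w, lap u (x + w) * profilePotential β 1 b (‖w‖ ^ 2))]

theorem sqrt_mul_norm_le (hβ : IsProfile β) {w : Plane} (ha : 0 ≤ a) (h : β (a * ‖w‖ ^ 2) ≠ 0) :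
    Real.sqrt a * ‖w‖ ≤ 3 := by
  have h5 : a * ‖w‖ ^ 2 < 5 := by
    by_contra hc
    exact h (hβ.eq_zero_right _ (not_lt.1 hc))
  refine abs_le_of_sq_le_sq' ?_ (by norm_num) |>.2
  rw [mul_pow, Real.sq_sqrt ha]
  linarith

/-- A derivative of `rho β b` costs one inverse length `√b`, at the price of a wider profile. -/
theorem abs_pd_rho_le {β' : ℝ → ℝ} {C : ℝ} (hβ : IsProfile β) (hβ' : IsProfile β')
    (hC : ∀ s, |deriv β s| ≤ C * β' s) (hb : 0 < b) (i : Fin 2) (w : Plane) :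
    |pd i (rho β b) w| ≤ 6 * C * Real.sqrt b * rho β' b w := by
  have hsm : ContDiff ℝ ∞ fun s => 2 * b * β (b * s) :=
    contDiff_const.mul (hβ.smooth.comp (contDiff_const.mul contDiff_id))
  have hd (s : ℝ) : deriv (fun s => 2 * b * β (b * s)) s = 2 * b * (deriv β (b * s) * b) := by
    have := ((hβ.smooth.differentiable (by simp) (b * s)).hasDerivAt.comp s
      ((hasDerivAt_id s).const_mul b)).const_mul (2 * b)
    simpa [Function.comp_def] using this.deriv
  have h1 : |w i| ≤ ‖w‖ := by simpa using PiLp.norm_apply_le w i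
  have e : pd i (rho β b) w = 2 * w i * (2 * b * (deriv β (b * ‖w‖ ^ 2) * b)) := by
    rw [← hd]; exact pd_comp_norm_sq hsm i w
  have hsb := Real.sq_sqrt hb.le
  have hs0 := Real.sqrt_pos.2 hb
  have hCs := hC (b * ‖w‖ ^ 2)
  rw [e, rho, abs_mul, abs_mul, abs_mul, abs_mul, abs_mul, abs_two, abs_of_pos hb]
  by_cases hz : β' (b * ‖w‖ ^ 2) = 0
  · rw [hz, mul_zero] at hCs
    rw [hz, le_antisymm hCs (abs_nonneg _)]
    simp
  · have h3 := hβ'.sqrt_mul_norm_le hb.le hz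
    have hCs0 : 0 ≤ C * β' (b * ‖w‖ ^ 2) := (abs_nonneg _).trans hCs
    calc 2 * |w i| * (2 * b * (|deriv β (b * ‖w‖ ^ 2)| * b))
        ≤ 2 * ‖w‖ * (2 * b * (C * β' (b * ‖w‖ ^ 2) * b)) := by gcongr
      _ = 4 * b * Real.sqrt b * (C * β' (b * ‖w‖ ^ 2)) * (Real.sqrt b * ‖w‖) := by
          linear_combination (-4 * b * C * β' (b * ‖w‖ ^ 2) * ‖w‖) * hsb
      _ ≤ 4 * b * Real.sqrt b * (C * β' (b * ‖w‖ ^ 2)) * 3 := by gcongr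
      _ = 6 * C * Real.sqrt b * (2 * b * β' (b * ‖w‖ ^ 2)) := by ring

end IsProfile

/-! ### Limits at small and large scales -/

theorem continuous_integral_comp_add_mul {g κ : Plane → ℝ} (hg : Continuous g) (hκ : Continuous κ)
    (hs : HasCompactSupport κ) : Continuous fun x => ∫ w, g (x + w) * κ w := by
  have h : (fun x => ∫ w, g (x + w) * κ w) = fun x => ∫ w in tsupport κ, g (x + w) * κ w := by
    funext x
    refine (setIntegral_eq_integral_of_forall_compl_eq_zero fun w hw => ?_).symm
    rw [image_eq_zero_of_notMem_tsupport hw, mul_zero]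
  rw [h]
  exact continuous_parametric_integral_of_continuous (by fun_prop) hs

/-- A profile together with a wider one that dominates its derivative. -/
theorem exists_isProfile : ∃ β β' : ℝ → ℝ, ∃ C : ℝ, IsProfile β ∧ IsProfile β' ∧ 0 ≤ C ∧
    (∀ s, |deriv β s| ≤ C * β' s) ∧ β 3 ≠ 0 := by
  let B : ContDiffBump (3 : ℝ) := ⟨1 / 2, 1, by norm_num, by norm_num⟩
  let B' : ContDiffBump (3 : ℝ) := ⟨1, 2, by norm_num, by norm_num⟩
  have hz {D : ContDiffBump (3 : ℝ)} (hD : D.rOut ≤ 2) {s : ℝ} (hs : s ≤ 1 ∨ 5 ≤ s) : D s = 0 := by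
    refine D.zero_of_le_dist (hD.trans ?_)
    rw [Real.dist_eq]
    rcases hs with h | h
    · rw [abs_of_nonpos] <;> linarith
    · rw [abs_of_nonneg] <;> linarith
  have hp (D : ContDiffBump (3 : ℝ)) (hD : D.rOut ≤ 2) : IsProfile D :=
    ⟨D.contDiff, fun _ => D.nonneg, fun _ h => hz hD (Or.inl h), fun _ h => hz hD (Or.inr h)⟩
  have hpB := hp B (by norm_num [B])
  obtain ⟨C, hC⟩ := (contDiff_deriv hpB.smooth).continuous.bounded_above_of_compact_support
    B.hasCompactSupport.deriv
  have hC0 : 0 ≤ C := (norm_nonneg _).trans (hC 0)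
  refine ⟨B, B', C, hpB, hp B' le_rfl, hC0, fun s => ?_, ?_⟩
  · by_cases hs : s ∈ tsupport B
    · rw [B.tsupport_eq] at hs
      rw [B'.one_of_mem_closedBall hs, mul_one]
      exact hC s
    · have : deriv B s = 0 := by
        by_contra h
        exact hs (support_deriv_subset h)
      rw [this, abs_zero]
      exact mul_nonneg hC0 B'.nonneg
  · rw [B.one_of_mem_closedBall (Metric.mem_closedBall_self B.rIn_pos.le)]
    exact one_ne_zero

theorem exists_small_scale_bound (A D : ℝ) {δ : ℝ} (hδ : 0 < δ) :
    ∃ b : ℝ, 0 < b ∧ b ≤ 1 ∧ Real.sqrt b * (A + D * Real.log (5 / b)) ≤ δ := by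
  have h1 : Filter.Tendsto (fun b : ℝ => Real.log b * b ^ (1 / 2 : ℝ))
      (nhdsWithin 0 (Set.Ioi 0)) (nhds 0) := tendsto_log_mul_rpow_nhdsGT_zero (by norm_num)
  have h2 : Filter.Tendsto (fun b : ℝ => Real.sqrt b) (nhdsWithin 0 (Set.Ioi 0)) (nhds 0) := by
    have := (Real.continuous_sqrt.tendsto 0).mono_left
      (nhdsWithin_le_nhds (s := Set.Ioi (0 : ℝ)))
    simpa using this
  have h3 := (h2.const_mul (A + D * Real.log 5)).sub (h1.const_mul D)
  simp only [mul_zero, sub_zero] at h3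
  have hb1 : ∀ᶠ b : ℝ in nhdsWithin 0 (Set.Ioi 0), b ≤ 1 :=
    nhdsWithin_le_nhds (eventually_le_nhds one_pos)
  obtain ⟨b, h, hb, hb1⟩ :=
    ((h3.eventually_le_const hδ).and (Filter.Eventually.and self_mem_nhdsWithin hb1)).exists
  have hb0 : 0 < b := hb
  refine ⟨b, hb0, hb1, ?_⟩
  rw [Real.log_div (by norm_num) hb0.ne']
  rw [← Real.sqrt_eq_rpow] at h
  linarith

namespace IsProfile

variable {β β' : ℝ → ℝ} {u : Plane → ℝ}

/-- A nonpositive function with integrable Laplacian has averaged gradients tending to zero at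
large scales. This replaces Liouville's theorem: it rules out an additional harmonic part. -/
theorem exists_abs_integral_pd_mul_rho_le {C : ℝ} (hβ : IsProfile β) (hβ' : IsProfile β')
    (hC0 : 0 ≤ C) (hC : ∀ s, |deriv β s| ≤ C * β' s) (hu : ContDiff ℝ ∞ u)
    (hl : Integrable (lap u)) (hneg : ∀ x, u x ≤ 0) (i : Fin 2) (M : ℝ) {δ : ℝ} (hδ : 0 < δ) :
    ∃ b, 0 < b ∧ b ≤ 1 ∧ ∀ x, ‖x‖ ≤ M → |∫ w, pd i u (x + w) * rho β b w| ≤ δ := by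
  obtain ⟨K, hK⟩ := (isCompact_closedBall (0 : Plane) M).exists_bound_of_continuousOn
    (continuous_integral_comp_add_mul hu.continuous.neg (hβ'.contDiff_rho (a := 1)).continuous
      (hβ'.hasCompactSupport_rho one_pos)).continuousOn
  obtain ⟨b, hb, hb1, hs⟩ := exists_small_scale_bound (6 * C * K)
    (6 * C * (mass β' 5 / 2 * ∫ w, |lap u w|)) hδ
  refine ⟨b, hb, hb1, fun x hx => ?_⟩
  have hg : ContDiff ℝ ∞ fun w => u (x + w) := hu.comp (contDiff_const.add contDiff_id)
  have hrs := hβ.hasCompactSupport_rho hb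
  have hibp := integral_pd_mul hg hβ.contDiff_rho hrs i
  simp only [pd_comp_const_add] at hibp
  have hi : Integrable fun w => -u (x + w) * rho β' b w :=
    integrable_mul_of_hasCompactSupport hg.continuous.neg hβ'.contDiff_rho.continuous
      (hβ'.hasCompactSupport_rho hb)
  have h1 : |∫ w, u (x + w) * pd i (rho β b) w|
      ≤ ∫ w, 6 * C * Real.sqrt b * (-u (x + w) * rho β' b w) := by
    rw [← Real.norm_eq_abs]
    refine norm_integral_le_of_norm_le (hi.const_mul _) (Filter.Eventually.of_forall fun w => ?_)
    rw [norm_mul, Real.norm_eq_abs, Real.norm_eq_abs, abs_of_nonpos (hneg _)]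
    refine (mul_le_mul_of_nonneg_left (hβ.abs_pd_rho_le hβ' hC hb i w)
      (neg_nonneg.2 (hneg _))).trans_eq ?_
    ring
  have h2 := hβ'.integral_neg_mul_rho_le hu hl hb hb1 x
  have h3 : ∫ w, -u (x + w) * rho β' 1 w ≤ K :=
    (le_abs_self _).trans (hK x (mem_closedBall_zero_iff.2 hx))
  rw [integral_const_mul] at h1
  rw [hibp, abs_neg]
  calc _ ≤ 6 * C * Real.sqrt b * ∫ w, -u (x + w) * rho β' b w := h1
    _ ≤ 6 * C * Real.sqrt b * (K + mass β' 5 / 2 * Real.log (5 / b) * ∫ w, |lap u w|) := by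
        gcongr
        exact h2.trans (by linarith)
    _ = Real.sqrt b * (6 * C * K
          + 6 * C * (mass β' 5 / 2 * ∫ w, |lap u w|) * Real.log (5 / b)) := by ring
    _ ≤ δ := hs

/-- The averages of a continuous function at small scales recover the function, uniformly on
balls. -/
theorem exists_abs_integral_mul_rho_sub_le (hβ : IsProfile β) {g : Plane → ℝ} (hg : Continuous g)
    (M : ℝ) {δ : ℝ} (hδ : 0 < δ) :
    ∃ a, 1 ≤ a ∧ ∀ x, ‖x‖ ≤ M →
      |(∫ w, g (x + w) * rho β a w) - (∫ w, rho β 1 w) * g x| ≤ δ * ∫ w, rho β 1 w := by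
  obtain ⟨η, hη, hηc⟩ := Metric.uniformContinuousOn_iff.1
    ((isCompact_closedBall (0 : Plane) (M + 1)).uniformContinuousOn_of_continuous
      hg.continuousOn) δ hδ
  -- on the support of `rho β (r ^ 2)` one has `r * ‖w‖ ≤ 3`, hence `‖w‖ < min η 1`: the steps stay
  -- within the range `η` of uniform continuity and inside the ball of radius `M + 1`
  set r : ℝ := max 1 (4 / min η 1) with hr
  have hm : 0 < min η 1 := lt_min hη one_pos
  have hr1 : 1 ≤ r := le_max_left _ _
  have ha1 : 1 ≤ r ^ 2 := one_le_pow₀ hr1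
  have ha0 : 0 < r ^ 2 := by positivity
  refine ⟨r ^ 2, ha1, fun x hx => ?_⟩
  have hi : Integrable (rho β (r ^ 2)) :=
    hβ.contDiff_rho.continuous.integrable_of_hasCompactSupport (hβ.hasCompactSupport_rho ha0)
  have hgi : Integrable fun w => g (x + w) * rho β (r ^ 2) w :=
    integrable_mul_of_hasCompactSupport (by fun_prop) hβ.contDiff_rho.continuous
      (hβ.hasCompactSupport_rho ha0)
  rw [← hβ.integral_rho_eq one_pos ha1, mul_comm _ (g x), ← integral_const_mul,
    ← integral_const_mul, ← integral_sub hgi (hi.const_mul _), ← Real.norm_eq_abs]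
  refine norm_integral_le_of_norm_le (hi.const_mul _) (Filter.Eventually.of_forall fun w => ?_)
  rw [← sub_mul, norm_mul, Real.norm_eq_abs, Real.norm_eq_abs,
    abs_of_nonneg (hβ.rho_nonneg ha0.le w)]
  by_cases hw : β (r ^ 2 * ‖w‖ ^ 2) = 0
  · simp [rho, hw]
  refine mul_le_mul_of_nonneg_right ?_ (hβ.rho_nonneg ha0.le w)
  have h3 := hβ.sqrt_mul_norm_le ha0.le hw
  rw [Real.sqrt_sq (by positivity)] at h3
  have h4 : 4 ≤ r * min η 1 := by
    rw [← div_le_iff₀ hm]; exact le_max_right _ _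
  have hwm : ‖w‖ < min η 1 := by
    by_contra hc
    have := mul_le_mul_of_nonneg_left (not_lt.1 hc) (zero_le_one.trans hr1)
    linarith
  refine (hηc (x + w) ?_ x ?_ ?_).le
  · rw [mem_closedBall_zero_iff]
    linarith [norm_add_le x w, hwm.trans_le (min_le_right _ _)]
  · rw [mem_closedBall_zero_iff]
    linarith
  · rw [dist_eq_norm, add_sub_cancel_left]
    exact hwm.trans_le (min_le_left _ _)

end IsProfile

/-! ### The self-force and the translation identity -/

/-- A nonpositive function with integrable Laplacian exerts, tested against a Lipschitz weight, a
total self-force `∫ φ Δu ∂ᵢu` controlled by the Lipschitz constant of the weight. -/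
theorem exists_abs_integral_mul_lap_mul_pd_le : ∃ S : ℝ, 0 ≤ S ∧ ∀ u : Plane → ℝ, ContDiff ℝ ∞ u →
    Integrable (lap u) → (∀ x, u x ≤ 0) → ∀ (i : Fin 2) (φ : Plane → ℝ) (L : ℝ), Continuous φ →
    HasCompactSupport φ → 0 ≤ L → (∀ x y, |φ x - φ y| ≤ L * ‖x - y‖) →
    |∫ x, φ x * lap u x * pd i u x| ≤ L * S * (∫ x, |lap u x|) ^ 2 := by
  obtain ⟨β, β', C, hβ, hβ', hC0, hC, hβ3⟩ := exists_isProfile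
  have hc := hβ.integral_rho_pos (by norm_num) hβ3
  set c := ∫ w, rho β 1 w with hcdef
  refine ⟨mass β 5 / 2 / c, by have := hβ.mass_nonneg 5; positivity, ?_⟩
  intro u hu hl hneg i φ L hφ hφs hL hφL
  obtain ⟨B, hB⟩ := hφ.bounded_above_of_compact_support hφs
  obtain ⟨M, hM⟩ := hφs.isCompact.isBounded.subset_closedBall (0 : Plane)
  have hlc := (contDiff_lap hu).continuous
  have hφl : Continuous fun x => φ x * lap u x := hφ.mul hlc
  have hφls : HasCompactSupport fun x => φ x * lap u x := hφs.mul_right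
  have hi {g : Plane → ℝ} (hg : Continuous g) : Integrable fun x => φ x * lap u x * g x :=
    (hφl.mul hg).integrable_of_hasCompactSupport hφls.mul_right
  set N := ∫ x, |φ x * lap u x| with hN
  have hN0 : 0 ≤ N := integral_nonneg fun _ => abs_nonneg _
  have key : c * |∫ x, φ x * lap u x * pd i u x|
      ≤ L * mass β 5 / 2 * (∫ x, |lap u x|) ^ 2 := by
    refine le_of_forall_pos_le_add fun ε hε => ?_
    have hδ : 0 < ε / ((c + 1) * (N + 1)) := by positivity
    set δ := ε / ((c + 1) * (N + 1)) with hδdef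
    obtain ⟨a, ha, hPa⟩ :=
      hβ.exists_abs_integral_mul_rho_sub_le (contDiff_pd hu i).continuous M hδ
    obtain ⟨b, hb, hb1, hPb⟩ :=
      hβ.exists_abs_integral_pd_mul_rho_le hβ' hC0 hC hu hl hneg i M hδ
    have hab : b ≤ a := hb1.trans ha
    set κ : Plane → ℝ := pd i fun w => profilePotential β a b (‖w‖ ^ 2) with hκ
    have hκc : Continuous κ :=
      (contDiff_pd (contDiff_comp_norm_sq hβ.contDiff_profilePotential) i).continuous
    have hκs : HasCompactSupport κ :=
      hasCompactSupport_pd (hβ.hasCompactSupport_profilePotential hb hab) i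
    have hodd (w : Plane) : κ (-w) = -κ w := by
      simp [hκ, hβ.pd_profilePotential]
    have hJ := abs_integral_odd_kernel_le hl hφ hB hφL hL hκc hκs hodd
      (hβ.norm_mul_abs_pd_profilePotential_le i)
    have hdiff : |c * (∫ x, φ x * lap u x * pd i u x)
        + ∫ x, φ x * lap u x * ∫ w, lap u (x + w) * κ w| ≤ ε := by
      have hcont := continuous_integral_comp_add_mul hlc hκc hκs
      rw [← integral_const_mul, ← integral_add ((hi (contDiff_pd hu i).continuous).const_mul c)
        (hi hcont), ← Real.norm_eq_abs]
      have hb2 : ∀ x, ‖c * (φ x * lap u x * pd i u x) + φ x * lap u x * ∫ w, lap u (x + w) * κ w‖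
          ≤ (c + 1) * δ * |φ x * lap u x| := by
        intro x
        have e := hβ.integral_pd_mul_rho_sub hu hb hab i x
        rw [show c * (φ x * lap u x * pd i u x) + φ x * lap u x * ∫ w, lap u (x + w) * κ w
          = (φ x * lap u x) * (c * pd i u x + ∫ w, lap u (x + w) * κ w) by ring, norm_mul,
          mul_comm, Real.norm_eq_abs, Real.norm_eq_abs]
        by_cases hx : φ x = 0
        · simp [hx]
        refine mul_le_mul_of_nonneg_right ?_ (abs_nonneg _)
        have hxM : ‖x‖ ≤ M := mem_closedBall_zero_iff.1 (hM (subset_tsupport φ hx))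
        have h1 := abs_le.1 (hPa x hxM)
        have h2 := abs_le.1 (hPb x hxM)
        rw [← hcdef] at h1
        rw [abs_le]
        constructor <;> linarith [h1.1, h1.2, h2.1, h2.2]
      refine (norm_integral_le_of_norm_le
        ((hφl.integrable_of_hasCompactSupport hφls).abs.const_mul _)
        (Filter.Eventually.of_forall hb2)).trans ?_
      rw [integral_const_mul, ← hN, hδdef, mul_comm (c + 1), div_mul_eq_mul_div, div_mul_eq_mul_div,
        div_le_iff₀ (by positivity)]
      nlinarith [mul_pos hε (by positivity : 0 < c + 1)]
    have h3 : c * |∫ x, φ x * lap u x * pd i u x| = |c * ∫ x, φ x * lap u x * pd i u x| := by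
      rw [abs_mul, abs_of_pos hc]
    rw [h3]
    rw [abs_le] at hdiff hJ ⊢
    constructor <;> linarith [hdiff.1, hdiff.2, hJ.1, hJ.2]
  rw [← le_div_iff₀' hc] at key
  refine key.trans_eq ?_
  ring

theorem theorem1 (k : ℝ → ℝ) (hk : ContDiff ℝ ∞ k)
    (hk_mono : ∀ t : ℝ, 0 ≤ deriv k t)
    (hk_nontrivial : ∃ s t : ℝ, k s ≠ k t) :
    ¬ ∃ u : EuclideanSpace ℝ (Fin 2) → ℝ,
      ContDiff ℝ ∞ u ∧
      (∀ x, -(Δ u) x = k (x 0) * Real.exp (u x)) ∧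
      (∀ x, u x ≤ u 0) ∧ u 0 = 0 ∧
      Integrable (fun x => |k (x 0)| * Real.exp (u x)) volume ∧
      0 < ∫ x, k (x 0) * Real.exp (u x) := by
  rintro ⟨u, hu, heq, hmax, hu0, hint, -⟩
  have hneg (x : Plane) : u x ≤ 0 := hu0 ▸ hmax x
  have hlap (x : Plane) : lap u x = -(k (x 0) * Real.exp (u x)) := by
    rw [← laplacian_eq_lap hu, ← heq, neg_neg]
  have hf : ContDiff ℝ ∞ fun x : Plane => k (x 0) := hk.comp (contDiff_coord 0)
  have he : ContDiff ℝ ∞ fun x : Plane => Real.exp (u x) := hu.exp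
  have hl : Integrable (lap u) := by
    refine hint.mono (contDiff_lap hu).continuous.aestronglyMeasurable
      (Filter.Eventually.of_forall fun x => ?_)
    rw [hlap]
    simp
  -- the density `k'(x₀) eᵘ`, obtained by differentiating the equation along `x₀`
  set G : Plane → ℝ := fun x => deriv k (x 0) * Real.exp (u x) with hG
  have hGc : Continuous G := by
    have := (contDiff_deriv hk).continuous
    have := hu.continuous
    fun_prop
  have hG0 (x : Plane) : 0 ≤ G x := mul_nonneg (hk_mono _) (Real.exp_pos _).le
  have hGeq (x : Plane) : G x = -pd 0 (lap u) x + lap u x * pd 0 u x := by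
    have h1 : pd 0 (fun x : Plane => k (x 0)) x = deriv k (x 0) := by
      unfold pd
      have h := ((hk.differentiable (by simp) (x 0)).hasDerivAt).comp_hasFDerivAt x
        (EuclideanSpace.proj 0 : Plane →L[ℝ] ℝ).hasFDerivAt
      rw [show (fun x : Plane => k (x 0)) = k ∘ (EuclideanSpace.proj 0 : Plane →L[ℝ] ℝ) from rfl,
        h.fderiv]
      simp
    have h2 : pd 0 (fun x : Plane => Real.exp (u x)) x = Real.exp (u x) * pd 0 u x := by
      unfold pd
      rw [fderiv_exp (hu.differentiable (by simp) x)]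
      rfl
    have h3 : pd 0 (lap u) x = -pd 0 (fun x : Plane => k (x 0) * Real.exp (u x)) x := by
      rw [show lap u = fun x => -(k (x 0) * Real.exp (u x)) from funext hlap]
      unfold pd
      rw [fderiv_fun_neg]
      rfl
    rw [h3, pd_mul hf he, h1, h2, hlap, hG]
    ring
  obtain ⟨S, hS, hforce⟩ := exists_abs_integral_mul_lap_mul_pd_le
  set F := ∫ x, |lap u x| with hF
  have hF0 : 0 ≤ F := integral_nonneg fun _ => abs_nonneg _
  -- the self-force bound, together with `|∂₀φ| ≤ L`, in the translation identity
  have htest (φ : Plane → ℝ) (L : NNReal) (hφ : ContDiff ℝ ∞ φ) (hφs : HasCompactSupport φ)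
      (hφL : LipschitzWith L φ) : ∫ x, G x * φ x ≤ L * (F + S * F ^ 2) := by
    have hL' (x y : Plane) : |φ x - φ y| ≤ L * ‖x - y‖ := by
      simpa [Real.dist_eq, dist_eq_norm] using hφL.dist_le_mul x y
    have h1 := hforce u hu hl hneg 0 φ L hφ.continuous hφs L.2 hL'
    have hlu := contDiff_lap hu
    have i1 : Integrable fun x => pd 0 (lap u) x * φ x :=
      integrable_mul_of_hasCompactSupport (contDiff_pd hlu 0).continuous hφ.continuous hφs
    have i2 : Integrable fun x => φ x * lap u x * pd 0 u x :=
      ((hφ.continuous.mul hlu.continuous).mul (contDiff_pd hu 0).continuous)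
        |>.integrable_of_hasCompactSupport (hφs.mul_right.mul_right)
    have h2 : ∫ x, G x * φ x
        = (∫ x, lap u x * pd 0 φ x) + ∫ x, φ x * lap u x * pd 0 u x := by
      rw [← neg_neg (∫ x, lap u x * pd 0 φ x), ← integral_pd_mul hlu hφ hφs, ← integral_neg,
        ← integral_add (f := fun x => -(pd 0 (lap u) x * φ x)) i1.neg i2]
      congr 1
      funext x
      rw [hGeq]
      ring
    have h3 : |∫ x, lap u x * pd 0 φ x| ≤ ∫ x, L * |lap u x| := by
      rw [← Real.norm_eq_abs]
      refine norm_integral_le_of_norm_le (hl.abs.const_mul _) (Filter.Eventually.of_forall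
        fun x => ?_)
      rw [norm_mul, mul_comm]
      refine mul_le_mul_of_nonneg_right ?_ (abs_nonneg _)
      refine ((fderiv ℝ φ x).le_opNorm _).trans ?_
      simpa using norm_fderiv_le_of_lipschitz ℝ hφL (x₀ := x)
    rw [integral_const_mul] at h3
    rw [h2]
    linarith [le_abs_self (∫ x, lap u x * pd 0 φ x),
      le_abs_self (∫ x, φ x * lap u x * pd 0 u x)]
  -- a fixed bump `Φ` that sees a point where `G > 0`; its dilates `Φ (R⁻¹ • x)` with `R ≥ 2` dominate it
  -- and have Lipschitz constant `Λ / R`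
  obtain ⟨t, ht⟩ : ∃ t, deriv k t ≠ 0 := by
    by_contra! h
    obtain ⟨s, t, hst⟩ := hk_nontrivial
    exact hst (is_const_of_deriv_eq_zero (hk.differentiable (by simp)) h s t)
  let p : Plane := EuclideanSpace.single 0 t
  have hpos : 0 < ‖p‖ + 1 := by positivity
  let Φ : ContDiffBump (0 : Plane) := ⟨‖p‖ + 1, 2 * (‖p‖ + 1), hpos, by linarith⟩
  have hΦ : ContDiff ℝ ∞ Φ := Φ.contDiff
  obtain ⟨Λ, hΛ⟩ := (Φ.contDiff (n := 1)).lipschitzWith_of_hasCompactSupport Φ.hasCompactSupport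
    (by simp)
  have hGΦ : 0 < ∫ x, G x * Φ x := by
    refine (hGc.mul hΦ.continuous).integral_pos_of_hasCompactSupport_nonneg_nonzero
      Φ.hasCompactSupport.mul_left (fun x => mul_nonneg (hG0 x) Φ.nonneg) (x := p) ?_
    have h1 : Φ p = 1 := Φ.one_of_mem_closedBall (mem_closedBall_zero_iff.2 (by simp [Φ]))
    simp [hG, h1, p, ht]
  have hscale (R : ℝ) (hR : 2 ≤ R) : R * (∫ x, G x * Φ x) ≤ Λ * (F + S * F ^ 2) := by
    have hR0 : 0 < R := by linarith
    have hφ : ContDiff ℝ ∞ fun x : Plane => Φ (R⁻¹ • x) := hΦ.comp (contDiff_const_smul _)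
    have hφs : HasCompactSupport fun x : Plane => Φ (R⁻¹ • x) :=
      Φ.hasCompactSupport.comp_homeomorph (Homeomorph.smulOfNeZero R⁻¹ (inv_ne_zero hR0.ne'))
    have hφL : LipschitzWith (Λ * ‖R⁻¹‖₊) fun x : Plane => Φ (R⁻¹ • x) :=
      hΛ.comp (lipschitzWith_smul R⁻¹)
    have h1 := htest _ _ hφ hφs hφL
    have h2 : ∫ x, G x * Φ x ≤ ∫ x, G x * Φ (R⁻¹ • x) := by
      refine integral_mono
        (integrable_mul_of_hasCompactSupport hGc hΦ.continuous Φ.hasCompactSupport)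
        (integrable_mul_of_hasCompactSupport hGc hφ.continuous hφs) fun x => ?_
      refine mul_le_mul_of_nonneg_left ?_ (hG0 x)
      by_cases hx : Φ x = 0
      · rw [hx]; exact Φ.nonneg
      · have hx2 : ‖x‖ < 2 * (‖p‖ + 1) := by
          have : x ∈ Function.support Φ := hx
          rwa [Φ.support_eq, mem_ball_zero_iff] at this
        rw [Φ.one_of_mem_closedBall (x := R⁻¹ • x)]
        · exact Φ.le_one
        · rw [mem_closedBall_zero_iff, norm_smul, norm_inv, Real.norm_of_nonneg hR0.le,
            inv_mul_le_iff₀ hR0]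
          exact hx2.le.trans (mul_le_mul_of_nonneg_right hR hpos.le)
    have h3 : ((Λ * ‖R⁻¹‖₊ : NNReal) : ℝ) = Λ * R⁻¹ := by
      simp [abs_of_pos hR0]
    rw [h3] at h1
    rw [← le_div_iff₀' hR0]
    refine (h2.trans h1).trans_eq ?_
    field_simp
  have hSF : 0 ≤ Λ * (F + S * F ^ 2) := by positivity
  -- `R * ∫ G Φ` is unbounded in `R`, while the right-hand side of `hscale` is fixed
  have h := hscale (Λ * (F + S * F ^ 2) / (∫ x, G x * Φ x) + 2) (by
    have := div_nonneg hSF hGΦ.le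
    linarith)
  rw [add_mul, div_mul_cancel₀ _ hGΦ.ne'] at h
  linarith
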